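/- Setting. Consider a circuit $C$ on an $L_1\times L_2$ grid ($L_1$ rows, $L_2$ columns, $n=L_1L_2$) of qudits of dimension $q\ge 1$, consisting of finitely many unitary gates, each acting on one site or on two neighbouring sites, with starting state $|1\rangle^{\otimes n}$. Let $\mathcal D_C(\mathbf x)=|\langle \mathbf x|C|1\rangle^{\otimes n}|^2$, $\mathbf x\in[q]^n$, be the distribution of the outcome when all qudits are measured in the computational basis. Gate $g$ is in the lightcone of column $t$ if it acts on column $t$ or overlaps a later gate that is in this lightcone. Space-evolving block decimation (SEBD) with truncation error $\epsilon\ge 0$ per bond and no bond dimension cutoff maintains a pure state, viewed as a chain of $L_1$ rows, starting from the all-$|1\rangle$ state. In iteration $t=1,\dots,L_2$ it does the following. (1) Compression: for the cuts $c=1,\dots,L_1-1$ in turn (rows $\le c$ against rows $>c$), it takes a Schmidt decomposition of the current vector across the cut and discards as many of the smallest singular values (with their terms) as possible, provided that the sum of the squares of those discarded is at most $\epsilon$ and that at least one is kept; after the last cut the vector is normalized. (2) It applies, in the order of time, the gates that are in the lightcone of column $t$ but of no earlier column. (3) It measures column $t$ in the computational basis, sampling the outcome $\mathbf x_t\in[q]^{L_1}$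 from the Born distribution, projects column $t$ onto $\mathbf x_t$ and normalizes. The output is $\mathbf x=(\mathbf x_1,\dots,\mathbf x_{L_2})$; let $\mathcal D'_C$ be its distribution. Where Schmidt decompositions are not unique, any fixed choice is allowed, and the choice may depend on the outcomes observed so far. Let $\epsilon_i$ be the sum of the squares of all singular values discarded (at all cuts) in the compression of iteration $i$, and let $\Lambda$ be the sum of all singular values discarded in the whole run; these are random variables, as they depend on the measurement outcomes. Theorem. For every such circuit $C$, every $\epsilon\ge 0$ and every choice of the Schmidt decompositions, $$\frac12\,\|\mathcal D'_C-\mathcal D_C\|_1=\frac12\sum_{\mathbf x\in[q]^n}|\mathcal D'_C(\mathbf x)-\mathcal D_C(\mathbf x)|\;\le\;\mathbb E\sum_{i=1}^{L_2}\sqrt{2\epsilon_i}\;\le\;\sqrt2\;\mathbb E\,\Lambda ,$$ where the expectations are over the random measurement outcomes in a run of the algorithm, i.e. over $\mathbf x\sim\mathcal D'_C$. -/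

import Mathlib

noncomputable section

open scoped BigOperators

namespace SEBD

/-- Sites of a rectangular grid with `L₁` rows and `L₂` columns: `s.1` is the row of `s` and
`s.2` its column. -/
abbrev Site (L₁ L₂ : ℕ) : Type := Fin L₁ × Fin L₂

/-- Strings in `[q]^n`, one letter for every site; they label the computational basis. -/
abbrev Config (q L₁ L₂ : ℕ) : Type := Site L₁ L₂ → Fin q

/-- Measurement outcomes of one column: one letter for every row. -/
abbrev Column (q L₁ : ℕ) : Type := Fin L₁ → Fin q

/-- Pure (not necessarily normalized) states of all `n = L₁ L₂` qudits of dimension `q`. -/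
abbrev State (q L₁ L₂ : ℕ) : Type := EuclideanSpace ℂ (Config q L₁ L₂)

/-! ### Circuits -/

/-- A gate: a unitary acting on one site or on two neighbouring sites of the grid. -/
structure Gate (q L₁ L₂ : ℕ) where
  support : Finset (Site L₁ L₂)
  isLocal : (∃ a, support = {a}) ∨
    ∃ a b, (SimpleGraph.boxProd (SimpleGraph.pathGraph L₁) (SimpleGraph.pathGraph L₂)).Adj a b ∧
      support = {a, b}
  op : Matrix.unitaryGroup (support → Fin q) ℂ

/-- The action of a gate on a state (the gate's unitary on its support, tensored with the identity
on all other sites). -/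
def Gate.apply {q L₁ L₂ : ℕ} (g : Gate q L₁ L₂) (ψ : State q L₁ L₂) : State q L₁ L₂ :=
  WithLp.toLp 2 fun x => ∑ y : g.support → Fin q,
    g.op.1 (fun s => x s.1) y * ψ (fun s => if h : s ∈ g.support then y ⟨s, h⟩ else x s)

/-- A circuit: finitely many gates in an order in which they may be performed. (The gates of one
layer act on disjoint sites, so they may be listed in any order.) -/
structure Circuit (q L₁ L₂ : ℕ) where
  size : ℕ
  gate : Fin size → Gate q L₁ L₂

/-- Apply, in the order of time, those gates of the circuit whose index satisfies `p`. -/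
def Circuit.applyGates {q L₁ L₂ : ℕ} (C : Circuit q L₁ L₂) (p : Fin C.size → Prop)
    (ψ : State q L₁ L₂) : State q L₁ L₂ :=
  open Classical in
  ((List.finRange C.size).filter fun i => decide (p i)).foldl (fun φ i => (C.gate i).apply φ) ψ

/-- The starting state, in which every qudit is in the first computational basis state. -/
def initialState (q L₁ L₂ : ℕ) [NeZero q] : State q L₁ L₂ :=
  EuclideanSpace.single (fun _ => 0) 1

/-- The output distribution `D_C`: the probability that the output of `C` on the starting state
yields the string `x` when all qudits are measured in the computational basis. -/
def Circuit.outputProb {q L₁ L₂ : ℕ} [NeZero q] (C : Circuit q L₁ L₂) (x : Config q L₁ L₂) : ℝ :=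
  ‖(C.applyGates (fun _ => True) (initialState q L₁ L₂)) x‖ ^ 2

/-- `C.InLightcone t i`: the `i`-th gate is causally connected to the measurements of column `t`,
that is, it acts on that column or overlaps a later gate which is in the lightcone. -/
inductive Circuit.InLightcone {q L₁ L₂ : ℕ} (C : Circuit q L₁ L₂) (t : ℕ) : Fin C.size → Prop
  | base (i : Fin C.size) (s : Site L₁ L₂) (hs : s ∈ (C.gate i).support) (ht : s.2.val = t) :
      Circuit.InLightcone C t i
  | step (i j : Fin C.size) (hij : i < j)
      (h : ¬ Disjoint (C.gate i).support (C.gate j).support)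
      (hj : Circuit.InLightcone C t j) : Circuit.InLightcone C t i

/-- The operation `V_t`: apply the gates in the lightcone of column `t` (columns are counted from
`0`) that are in the lightcone of no earlier column. The state lives on the whole grid: qudits that
no performed gate has reached are still in their starting state, so nothing has to be adjoined. -/
def Circuit.applyV {q L₁ L₂ : ℕ} (C : Circuit q L₁ L₂) (t : ℕ) (ψ : State q L₁ L₂) :
    State q L₁ L₂ :=
  C.applyGates (fun i => C.InLightcone t i ∧ ∀ t' < t, ¬ C.InLightcone t' i) ψ

/-- The projection of column `t` onto the outcome string `a`. -/
def projectColumn {q L₁ L₂ : ℕ} (t : ℕ) (a : Column q L₁) (ψ : State q L₁ L₂) : State q L₁ L₂ :=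
  open Classical in
  WithLp.toLp 2 fun x => if ∀ s : Site L₁ L₂, s.2.val = t → x s = a s.1 then ψ x else 0

/-- Normalization of a vector (the zero vector is sent to itself). -/
def normalize {q L₁ L₂ : ℕ} (ψ : State q L₁ L₂) : State q L₁ L₂ :=
  ((‖ψ‖⁻¹ : ℝ) : ℂ) • ψ

/-! ### Compression of a matrix product state

The state is viewed as a chain of `L₁` sites, one for each row; the cut `c` separates the rows
`0, …, c - 1` from the rows `c, …, L₁ - 1`. -/

/-- Basis labels for the rows above the cut `c`. -/
abbrev Top (q L₁ L₂ c : ℕ) : Type := {s : Site L₁ L₂ // s.1.val < c} → Fin q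

/-- Basis labels for the rows below the cut `c`. -/
abbrev Bot (q L₁ L₂ c : ℕ) : Type := {s : Site L₁ L₂ // ¬ s.1.val < c} → Fin q

/-- A Schmidt decomposition `ψ = ∑ₖ sₖ |topₖ⟩ ⊗ |botₖ⟩` across the cut `c`, with the (nonzero)
singular values `sₖ` listed in decreasing order. -/
structure Schmidt {q L₁ L₂ : ℕ} (c : ℕ) (ψ : State q L₁ L₂) where
  rank : ℕ
  sv : Fin rank → ℝ
  top : Fin rank → EuclideanSpace ℂ (Top q L₁ L₂ c)
  bot : Fin rank → EuclideanSpace ℂ (Bot q L₁ L₂ c)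
  sv_pos : ∀ k, 0 < sv k
  sv_antitone : Antitone sv
  top_orthonormal : Orthonormal ℂ top
  bot_orthonormal : Orthonormal ℂ bot
  decomp : ∀ x, ψ x = ∑ k, (sv k : ℂ) * top k (fun s => x s.1) * bot k (fun s => x s.1)

/-- The sum of the squares of all but the `r` largest singular values. -/
def Schmidt.tailSq {q L₁ L₂ c : ℕ} {ψ : State q L₁ L₂} (S : Schmidt c ψ) (r : ℕ) : ℝ :=
  ∑ k : Fin S.rank, if r ≤ k.val then S.sv k ^ 2 else 0

/-- The sum of all but the `r` largest singular values. -/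
def Schmidt.tailSum {q L₁ L₂ c : ℕ} {ψ : State q L₁ L₂} (S : Schmidt c ψ) (r : ℕ) : ℝ :=
  ∑ k : Fin S.rank, if r ≤ k.val then S.sv k else 0

/-- Truncation at the cut `c` with truncation error `ε`: the `kept` largest singular values survive,
and as many of the smallest ones as possible are discarded, subject to the sum of the squares of the
discarded ones being at most `ε` (and to at least one being kept if there is any, so that a nonzero
state is not truncated to zero). -/
structure CutTruncation {q L₁ L₂ : ℕ} (ε : ℝ) (c : ℕ) (ψ : State q L₁ L₂) extends
    Schmidt c ψ where
  kept : ℕ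
  kept_le : kept ≤ rank
  kept_pos : 0 < rank → 0 < kept
  within : toSchmidt.tailSq kept ≤ ε
  maximal : ∀ r, 0 < r → r < kept → ε < toSchmidt.tailSq r

/-- The state that remains after the truncation at the cut `c` (before renormalization). -/
def CutTruncation.result {q L₁ L₂ c : ℕ} {ε : ℝ} {ψ : State q L₁ L₂}
    (T : CutTruncation ε c ψ) : State q L₁ L₂ :=
  WithLp.toLp 2 fun x => ∑ k : Fin T.rank,
    if k.val < T.kept then (T.sv k : ℂ) * T.top k (fun s => x s.1) * T.bot k (fun s => x s.1) else 0

/-- A sweep over a list of cuts: the current state is truncated at one cut after the other. -/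
inductive Sweep {q L₁ L₂ : ℕ} (ε : ℝ) : List ℕ → State q L₁ L₂ → Type
  | nil (ψ : State q L₁ L₂) : Sweep ε [] ψ
  | cons {c : ℕ} {cs : List ℕ} {ψ : State q L₁ L₂} (T : CutTruncation ε c ψ)
      (rest : Sweep ε cs T.result) : Sweep ε (c :: cs) ψ

/-- The state at the end of a sweep (before renormalization). -/
def Sweep.result {q L₁ L₂ : ℕ} {ε : ℝ} :
    {cs : List ℕ} → {ψ : State q L₁ L₂} → Sweep ε cs ψ → State q L₁ L₂
  | _, _, .nil ψ => ψ
  | _, _, .cons _ rest => rest.result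

/-- The sum of the squares of all singular values discarded in a sweep. -/
def Sweep.discardedSq {q L₁ L₂ : ℕ} {ε : ℝ} :
    {cs : List ℕ} → {ψ : State q L₁ L₂} → Sweep ε cs ψ → ℝ
  | _, _, .nil _ => 0
  | _, _, .cons T rest => T.tailSq T.kept + rest.discardedSq

/-- The sum of all singular values discarded in a sweep. -/
def Sweep.discardedSum {q L₁ L₂ : ℕ} {ε : ℝ} :
    {cs : List ℕ} → {ψ : State q L₁ L₂} → Sweep ε cs ψ → ℝ
  | _, _, .nil _ => 0
  | _, _, .cons T rest => T.tailSum T.kept + rest.discardedSum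

/-- A compression of the state `ψ`: a sweep over all `L₁ - 1` cuts of the chain of rows. -/
abbrev Compression {q L₁ L₂ : ℕ} (ε : ℝ) (ψ : State q L₁ L₂) : Type :=
  Sweep ε (List.range' 1 (L₁ - 1)) ψ

/-- A compression routine. Schmidt decompositions are not unique when singular values coincide;
the routine fixes the ones that are used, possibly depending on the list of the column outcomes
observed so far (latest outcome first). -/
abbrev Compressor (q L₁ L₂ : ℕ) (ε : ℝ) : Type :=
  List (Column q L₁) → ∀ ψ : State q L₁ L₂, Compression ε ψ

/-! Compression routines exist, so a statement about all of them is not vacuous. -/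

/-- Singular value decomposition of a matrix. -/
theorem exists_svd {A B : Type*} [Fintype A] [DecidableEq A] [Fintype B] (M : Matrix A B ℂ) :
    ∃ (m : ℕ) (s : Fin m → ℝ) (u : Fin m → EuclideanSpace ℂ A) (v : Fin m → EuclideanSpace ℂ B),
      (∀ k, 0 < s k) ∧ Antitone s ∧ Orthonormal ℂ u ∧ Orthonormal ℂ v ∧
      ∀ a b, M a b = ∑ k, (s k : ℂ) * u k a * v k b := by
  classical
  have hH := Matrix.isHermitian_mul_conjTranspose_self M
  let U := hH.eigenvectorBasis
  let w : A → EuclideanSpace ℂ B := fun k => WithLp.toLp 2 fun b => ∑ a, star (U k a) * M a b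
  have hU : ∀ j k, ∑ a, star (U j a) * U k a = if j = k then 1 else 0 := by
    intro j k
    have h := orthonormal_iff_ite.1 U.orthonormal j k
    simpa [PiLp.inner_apply, mul_comm] using h
  have hw : ∀ j k, j ≠ k → inner ℂ (w j) (w k) = 0 := by
    intro j k hjk
    have h1 : inner ℂ (w j) (w k) =
        ∑ a', star (U k a') * ((M * M.conjTranspose).mulVec (U j)) a' := by
      simp only [PiLp.inner_apply, RCLike.inner_apply, w, Matrix.mulVec, dotProduct,
        Matrix.mul_apply, Matrix.conjTranspose_apply, map_sum, map_mul, Finset.mul_sum,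
        Finset.sum_mul, starRingEnd_apply, star_star]
      rw [Finset.sum_comm]
      simp_rw [Finset.sum_comm (γ := B)]
      rw [Finset.sum_comm]
      refine Finset.sum_congr rfl fun a _ => Finset.sum_congr rfl fun a' _ =>
        Finset.sum_congr rfl fun b _ => ?_
      ring
    rw [h1, hH.mulVec_eigenvectorBasis j]
    have := hU k j
    simp only [Pi.smul_apply, Complex.real_smul]
    simp_rw [mul_left_comm _ (_ : ℂ) _]
    rw [← Finset.mul_sum, this, if_neg (Ne.symm hjk), mul_zero]
  have hM : ∀ a b, M a b = ∑ k, U k a * w k b := by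
    intro a b
    have h := U.sum_repr' (WithLp.toLp 2 fun a => M a b)
    have h2 := congrArg (fun z : EuclideanSpace ℂ A => z a) h
    simp only [WithLp.ofLp_sum, Finset.sum_apply, PiLp.smul_apply, smul_eq_mul] at h2
    rw [← h2]
    refine Finset.sum_congr rfl fun k _ => ?_
    rw [mul_comm]
    congr 1
    simp [PiLp.inner_apply, w, mul_comm]
  let K := {k : A // w k ≠ 0}
  let e : Fin (Fintype.card K) ≃ K := (Fintype.equivFin K).symm
  let σ := Tuple.sort fun i => -‖w (e i).1‖
  let g : Fin (Fintype.card K) → A := fun i => (e (σ i)).1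
  have hg : Function.Injective g :=
    Subtype.val_injective.comp (e.injective.comp σ.injective)
  have hpos : ∀ i, 0 < ‖w (g i)‖ := fun i => norm_pos_iff.2 (e (σ i)).2
  refine ⟨_, fun i => ‖w (g i)‖, fun i => U (g i),
    fun i => ((‖w (g i)‖⁻¹ : ℝ) : ℂ) • w (g i), hpos, ?_, U.orthonormal.comp g hg, ⟨?_, ?_⟩, ?_⟩
  · intro i j hij
    have := Tuple.monotone_sort (fun i => -‖w (e i).1‖) hij
    simpa using this
  · intro i
    rw [norm_smul, Complex.norm_real, norm_inv, norm_norm, inv_mul_cancel₀ (hpos i).ne']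
  · intro i j hij
    simp only [inner_smul_left, inner_smul_right]
    rw [hw _ _ (hg.ne hij)]
    simp
  · intro a b
    rw [hM]
    have h1 : ∑ k, U k a * w k b = ∑ k : K, U k.1 a * w k.1 b := by
      rw [← Finset.sum_filter_add_sum_filter_not Finset.univ (fun k => w k ≠ 0)]
      have h0 : ∑ k with ¬ w k ≠ 0, U k a * w k b = 0 := by
        refine Finset.sum_eq_zero fun k hk => ?_
        rw [not_not.1 (Finset.mem_filter.1 hk).2]
        simp
      rw [h0, add_zero]
      exact Finset.sum_subtype _ (by simp) _
    rw [h1, ← (σ.trans e).sum_comp]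
    refine Finset.sum_congr rfl fun i _ => ?_
    have : (‖w (g i)‖ : ℂ) ≠ 0 := by exact_mod_cast (hpos i).ne'
    simp only [PiLp.smul_apply, smul_eq_mul, Complex.ofReal_inv]
    change U (g i) a * w (g i) b = _
    field_simp

theorem nonempty_schmidt {q L₁ L₂ : ℕ} (c : ℕ) (ψ : State q L₁ L₂) : Nonempty (Schmidt c ψ) := by
  classical
  obtain ⟨m, s, u, v, h1, h2, h3, h4, h5⟩ := exists_svd
    (fun (a : Top q L₁ L₂ c) (b : Bot q L₁ L₂ c) =>
      ψ fun x => if h : x.1.val < c then a ⟨x, h⟩ else b ⟨x, h⟩)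
  refine ⟨⟨m, s, u, v, h1, h2, h3, h4, fun x => ?_⟩⟩
  rw [← h5]
  refine congrArg ψ.ofLp (funext fun y => ?_)
  split_ifs <;> rfl

theorem nonempty_cutTruncation {q L₁ L₂ : ℕ} {ε : ℝ} (hε : 0 ≤ ε) (c : ℕ) (ψ : State q L₁ L₂) :
    Nonempty (CutTruncation ε c ψ) := by
  classical
  obtain ⟨S⟩ := nonempty_schmidt c ψ
  have hex : ∃ r, (0 < S.rank → 0 < r) ∧ S.tailSq r ≤ ε := by
    refine ⟨S.rank, id, le_of_eq_of_le ?_ hε⟩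
    exact Finset.sum_eq_zero fun k _ => if_neg (not_le.2 k.2)
  refine ⟨⟨S, Nat.find hex, Nat.find_min' hex ⟨id, ?_⟩, (Nat.find_spec hex).1,
    (Nat.find_spec hex).2, fun r hr hlt => ?_⟩⟩
  · exact le_of_eq_of_le (Finset.sum_eq_zero fun k _ => if_neg (not_le.2 k.2)) hε
  · have := Nat.find_min hex hlt
    by_contra hcon
    exact this ⟨fun _ => hr, not_lt.1 hcon⟩

theorem nonempty_sweep {q L₁ L₂ : ℕ} {ε : ℝ} (hε : 0 ≤ ε) :
    ∀ (cs : List ℕ) (ψ : State q L₁ L₂), Nonempty (Sweep ε cs ψ)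
  | [], ψ => ⟨.nil ψ⟩
  | c :: cs, ψ => by
    obtain ⟨T⟩ := nonempty_cutTruncation hε c ψ
    obtain ⟨R⟩ := nonempty_sweep hε cs T.result
    exact ⟨.cons T R⟩

/-- Compression routines exist. -/
theorem nonempty_compressor {q L₁ L₂ : ℕ} {ε : ℝ} (hε : 0 ≤ ε) :
    Nonempty (Compressor q L₁ L₂ ε) :=
  ⟨fun _ ψ => (nonempty_sweep hε _ ψ).some⟩

/-! ### The algorithm, without bond dimension cutoff -/

/-- The state of the algorithm before the compression in the iteration that follows the column
outcomes `h` (latest outcome first): compress, renormalize, apply `V_t`, project column `t` onto the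
observed outcome, renormalize. -/
def stateBefore {q L₁ L₂ : ℕ} [NeZero q] {ε : ℝ} (C : Circuit q L₁ L₂)
    (T : Compressor q L₁ L₂ ε) : List (Column q L₁) → State q L₁ L₂
  | [] => initialState q L₁ L₂
  | a :: h => normalize (projectColumn h.length a
      (C.applyV h.length (normalize (T h (stateBefore C T h)).result)))

/-- The compression that the algorithm performs after the column outcomes `h`. -/
def compressionAt {q L₁ L₂ : ℕ} [NeZero q] {ε : ℝ} (C : Circuit q L₁ L₂)
    (T : Compressor q L₁ L₂ ε) (h : List (Column q L₁)) : Compression ε (stateBefore C T h) :=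
  T h (stateBefore C T h)

/-- The probability with which the algorithm samples the outcome `a` for the next column after the
column outcomes `h`. -/
def condProb {q L₁ L₂ : ℕ} [NeZero q] {ε : ℝ} (C : Circuit q L₁ L₂)
    (T : Compressor q L₁ L₂ ε) (h : List (Column q L₁)) (a : Column q L₁) : ℝ :=
  ‖projectColumn h.length a (C.applyV h.length (normalize (compressionAt C T h).result))‖ ^ 2

/-- The outcomes of the first `t` columns of the string `x`, latest first. -/
def history {q L₁ L₂ : ℕ} (x : Config q L₁ L₂) (t : ℕ) : List (Column q L₁) :=
  ((List.finRange L₂).take t).reverse.map fun j i => x (i, j)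

/-- The distribution `D'_C` of the string that the algorithm samples. -/
def sampleProb {q L₁ L₂ : ℕ} [NeZero q] {ε : ℝ} (C : Circuit q L₁ L₂)
    (T : Compressor q L₁ L₂ ε) (x : Config q L₁ L₂) : ℝ :=
  ∏ t : Fin L₂, condProb C T (history x t) fun i => x (i, t)

/-- Expectation of `f` over the measurement outcomes in a run of the algorithm. -/
def expect {q L₁ L₂ : ℕ} [NeZero q] {ε : ℝ} (C : Circuit q L₁ L₂)
    (T : Compressor q L₁ L₂ ε) (f : Config q L₁ L₂ → ℝ) : ℝ :=
  ∑ x, sampleProb C T x * f x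

/-- The sum of the squares of all singular values discarded in the compression in iteration `t`
(counted from `0`), when the sampled string is `x`. -/
def truncError {q L₁ L₂ : ℕ} [NeZero q] {ε : ℝ} (C : Circuit q L₁ L₂)
    (T : Compressor q L₁ L₂ ε) (x : Config q L₁ L₂) (t : Fin L₂) : ℝ :=
  (compressionAt C T (history x t)).discardedSq

/-- The sum of all singular values discarded over the course of the algorithm, when the sampled
string is `x`. -/
def totalDiscarded {q L₁ L₂ : ℕ} [NeZero q] {ε : ℝ} (C : Circuit q L₁ L₂)
    (T : Compressor q L₁ L₂ ε) (x : Config q L₁ L₂) : ℝ :=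
  ∑ t : Fin L₂, (compressionAt C T (history x t)).discardedSum

end SEBD

end

/-!
# Sampling error of space-evolving block decimation

The proof is a hybrid argument over the columns, with two ingredients.

*A compression moves the state by at most `√(2δ)`*, where `δ` is the sum of the squares of all
singular values discarded in it. The truncation at the cut `c` discards the components along certain
Schmidt vectors on the rows above `c`, and it equally is an orthogonal projection that acts on the
rows below `c` only. Hence the truncations at later cuts do not bring back what has been discarded
(`CutTruncation.inner_sub_result`), so a unit vector `ψ` and the state `φ` at the end of the sweep
satisfy `⟨ψ, φ⟩ = ‖φ‖² = 1 - δ` (`Sweep.inner_result`, `Sweep.norm_result_sq`). After normalization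
the distance is `√(2 - 2√(1 - δ)) ≤ √(2δ)`.

*Without compression the algorithm is exact* (`Circuit.norm_exactRun_sq`). Sort the gates by the
first column in whose lightcone they are. A gate which is moved behind a later gate in this way is
disjoint from it, since otherwise it would be in the lightcone of the same column
(`Circuit.applyV_applyGates`). Gates sorted into a column do not act on the earlier columns, so the
projections of these can be postponed to the end (`Circuit.applyV_projectOn`).

The exact process for the remaining columns is linear and preserves the total squared norm, so
replacing its starting vector by another unit vector changes the `ℓ¹` distance of the outcome
distributions by at most twice the distance of the vectors
(`Circuit.sum_abs_norm_exactRun_sq_sub_le`). Backward induction over the columns, in which one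
compression after the other is inserted and each is averaged over the outcomes observed before it,
gives the first inequality (`sum_abs_tailProb_sub_le`). The second one holds for every run, because
a sum of squares of nonnegative numbers is at most the square of their sum.
-/

open scoped BigOperators

namespace SEBD

variable {q L₁ L₂ : ℕ}

/-! ### Splitting the sites of the grid in two -/

/-- The function on all sites assembled from a function on the sites satisfying `p` and a function
on the other sites. -/
def glue {σ α : Type*} (p : σ → Prop) [DecidablePred p] (a : {s // p s} → α)
    (b : {s // ¬ p s} → α) : σ → α :=
  fun s => if h : p s then a ⟨s, h⟩ else b ⟨s, h⟩

section Glue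

variable {σ α : Type*} (p : σ → Prop) [DecidablePred p]

@[simp]
theorem glue_pos (a : {s // p s} → α) (b : {s // ¬ p s} → α) (s : {s // p s}) :
    glue p a b s = a s := by
  simp [glue, s.2]

@[simp]
theorem glue_neg (a : {s // p s} → α) (b : {s // ¬ p s} → α) (s : {s // ¬ p s}) :
    glue p a b s = b s := by
  simp [glue, s.2]

theorem sum_glue [Fintype (σ → α)] [Fintype ({s // p s} → α)] [Fintype ({s // ¬ p s} → α)]
    {M : Type*} [AddCommMonoid M] (f : (σ → α) → M) :
    ∑ x, f x = ∑ a : {s // p s} → α, ∑ b : {s // ¬ p s} → α, f (glue p a b) := by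
  rw [← Fintype.sum_prod_type' (f := fun a b => f (glue p a b))]
  exact Fintype.sum_equiv (Equiv.piEquivPiSubtypeProd p fun _ => α) _ _ fun x =>
    congrArg f ((Equiv.piEquivPiSubtypeProd p fun _ => α).symm_apply_apply x).symm

end Glue

theorem norm_sq_state {q L₁ L₂ : ℕ} (ψ : State q L₁ L₂) : ‖ψ‖ ^ 2 = ∑ x, ‖ψ x‖ ^ 2 :=
  EuclideanSpace.norm_sq_eq ψ

/-! ### Truncation at the cuts -/

/-- The product vector `u ⊗ v` of a vector on the rows above the cut `c` and one on the rows
below. -/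
def cutProduct {c : ℕ} (u : EuclideanSpace ℂ (Top q L₁ L₂ c))
    (v : EuclideanSpace ℂ (Bot q L₁ L₂ c)) :
    State q L₁ L₂ :=
  WithLp.toLp 2 fun x => u (fun s => x s.1) * v (fun s => x s.1)

theorem inner_cutProduct_left {c : ℕ} (u : EuclideanSpace ℂ (Top q L₁ L₂ c))
    (v : EuclideanSpace ℂ (Bot q L₁ L₂ c)) (φ : State q L₁ L₂) :
    inner ℂ (cutProduct u v) φ = ∑ b : Bot q L₁ L₂ c, star (v b) *
      ∑ a : Top q L₁ L₂ c, star (u a) * φ (glue (fun s : Site L₁ L₂ => s.1.val < c) a b) := by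
  simp only [PiLp.inner_apply, RCLike.inner_apply, cutProduct]
  rw [sum_glue (fun s : Site L₁ L₂ => s.1.val < c), Finset.sum_comm]
  refine Finset.sum_congr rfl fun b _ => ?_
  rw [Finset.mul_sum]
  refine Finset.sum_congr rfl fun a _ => ?_
  simp only [glue_pos, glue_neg, map_mul, starRingEnd_apply]
  ring

theorem inner_cutProduct {c : ℕ} (u u' : EuclideanSpace ℂ (Top q L₁ L₂ c))
    (v v' : EuclideanSpace ℂ (Bot q L₁ L₂ c)) :
    inner ℂ (cutProduct u v) (cutProduct u' v') = inner ℂ u u' * inner ℂ v v' := by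
  rw [inner_cutProduct_left]
  simp only [PiLp.inner_apply, RCLike.inner_apply, cutProduct, glue_pos, glue_neg,
    starRingEnd_apply]
  rw [Finset.mul_sum]
  refine Finset.sum_congr rfl fun b _ => ?_
  rw [Finset.mul_sum, Finset.sum_mul]
  refine Finset.sum_congr rfl fun a _ => ?_
  ring

theorem Schmidt.orthonormal_cutProduct {c : ℕ} {ψ : State q L₁ L₂} (S : Schmidt c ψ) :
    Orthonormal ℂ fun k => cutProduct (S.top k) (S.bot k) := by
  rw [orthonormal_iff_ite]
  intro i j
  rw [inner_cutProduct, orthonormal_iff_ite.1 S.top_orthonormal,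
    orthonormal_iff_ite.1 S.bot_orthonormal]
  split_ifs <;> simp

theorem Schmidt.eq_sum {c : ℕ} {ψ : State q L₁ L₂} (S : Schmidt c ψ) :
    ψ = ∑ k, (S.sv k : ℂ) • cutProduct (S.top k) (S.bot k) := by
  ext x
  simp [S.decomp x, cutProduct, mul_assoc]

namespace CutTruncation

variable {ε : ℝ} {c : ℕ} {ψ : State q L₁ L₂} (T : CutTruncation ε c ψ)

theorem result_eq_sum :
    T.result = ∑ k, (if k.val < T.kept then (T.sv k : ℂ) else 0) •
      cutProduct (T.top k) (T.bot k) := by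
  ext x
  simp only [result, cutProduct, WithLp.ofLp_sum, WithLp.ofLp_smul, Finset.sum_apply,
    Pi.smul_apply, smul_eq_mul, ite_mul, zero_mul, mul_assoc]

theorem sub_result_eq_sum :
    ψ - T.result = ∑ k, (if T.kept ≤ k.val then (T.sv k : ℂ) else 0) •
      cutProduct (T.top k) (T.bot k) := by
  refine (congrArg₂ (· - ·) T.toSchmidt.eq_sum T.result_eq_sum).trans ?_
  rw [← Finset.sum_sub_distrib]
  refine Finset.sum_congr rfl fun k _ => ?_
  rw [← sub_smul]
  by_cases h : k.val < T.kept
  · simp [h]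
  · simp [h, not_lt.1 h]

theorem norm_sub_result_sq : ‖ψ - T.result‖ ^ 2 = T.tailSq T.kept := by
  have h := T.orthonormal_cutProduct.inner_sum
    (fun k => if T.kept ≤ k.val then (T.sv k : ℂ) else 0)
    (fun k => if T.kept ≤ k.val then (T.sv k : ℂ) else 0) Finset.univ
  rw [← sub_result_eq_sum, inner_self_eq_norm_sq_to_K] at h
  have h' : ((‖ψ - T.result‖ ^ 2 : ℝ) : ℂ) = ((T.tailSq T.kept : ℝ) : ℂ) := by
    push_cast [Schmidt.tailSq]
    refine h.trans (Finset.sum_congr rfl fun k _ => ?_)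
    split_ifs <;> simp [sq]
  exact_mod_cast h'

end CutTruncation

/-- `φ` is orthogonal to `u ⊗ v` for all vectors `v` on the rows below the cut `c`: the partial
inner product of `u` with `φ` vanishes. -/
def TopOrthogonal (c : ℕ) (u : EuclideanSpace ℂ (Top q L₁ L₂ c)) (φ : State q L₁ L₂) : Prop :=
  ∀ b : Bot q L₁ L₂ c,
    ∑ a : Top q L₁ L₂ c, star (u a) * φ (glue (fun s : Site L₁ L₂ => s.1.val < c) a b) = 0

theorem TopOrthogonal.inner_eq_zero {c : ℕ} {u : EuclideanSpace ℂ (Top q L₁ L₂ c)}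
    {φ : State q L₁ L₂} (h : TopOrthogonal c u φ) (v : EuclideanSpace ℂ (Bot q L₁ L₂ c)) :
    inner ℂ (cutProduct u v) φ = 0 := by
  rw [inner_cutProduct_left]
  exact Finset.sum_eq_zero fun b _ => by rw [h b, mul_zero]

/-- The Schmidt vectors discarded at a cut are orthogonal to the truncated state. -/
theorem CutTruncation.topOrthogonal_result {ε : ℝ} {c : ℕ} {ψ : State q L₁ L₂}
    (T : CutTruncation ε c ψ) {k : Fin T.rank} (hk : T.kept ≤ k.val) :
    TopOrthogonal c (T.top k) T.result := by
  intro b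
  simp only [CutTruncation.result, glue_pos, glue_neg, Finset.mul_sum]
  rw [Finset.sum_comm]
  refine Finset.sum_eq_zero fun j _ => ?_
  by_cases hj : j.val < T.kept
  · have hkj : k ≠ j := fun h => by rw [h] at hk; omega
    have h := T.top_orthonormal.2 hkj
    simp only [PiLp.inner_apply, RCLike.inner_apply, starRingEnd_apply] at h
    simp only [hj, if_true]
    calc _ = (T.sv j : ℂ) * T.bot j b * ∑ a, T.top j a * star (T.top k a) := by
          rw [Finset.mul_sum]
          exact Finset.sum_congr rfl fun a _ => by ring
      _ = 0 := by rw [h, mul_zero]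
  · simp [hj]

theorem Schmidt.sum_star_bot_mul {c : ℕ} {ψ : State q L₁ L₂} (S : Schmidt c ψ) (k : Fin S.rank)
    (a : Top q L₁ L₂ c) :
    ∑ y : Bot q L₁ L₂ c, star (S.bot k y) * ψ (glue (fun s : Site L₁ L₂ => s.1.val < c) a y) =
      (S.sv k : ℂ) * S.top k a := by
  simp_rw [S.decomp, glue_pos, glue_neg, Finset.mul_sum]
  rw [Finset.sum_comm]
  have h := orthonormal_iff_ite.1 S.bot_orthonormal k
  simp only [PiLp.inner_apply, RCLike.inner_apply, starRingEnd_apply] at h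
  calc _ = ∑ j, (S.sv j : ℂ) * S.top j a * ∑ y, S.bot j y * star (S.bot k y) := by
        refine Finset.sum_congr rfl fun j _ => ?_
        rw [Finset.mul_sum]
        exact Finset.sum_congr rfl fun y _ => by ring
    _ = _ := by simp only [h, mul_ite, mul_one, mul_zero, Finset.sum_ite_eq,
        Finset.mem_univ, if_true]

/-- A truncation at a later cut `c'` acts as a projection on the rows below `c'`, so it does not
affect partial inner products with vectors on the rows above an earlier cut. -/
theorem TopOrthogonal.result {c c' : ℕ} (hc : c ≤ c') {u : EuclideanSpace ℂ (Top q L₁ L₂ c)}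
    {φ : State q L₁ L₂} (h : TopOrthogonal c u φ) {ε : ℝ} (T : CutTruncation ε c' φ) :
    TopOrthogonal c u T.result := by
  intro b
  let bb : Bot q L₁ L₂ c' := fun s => b ⟨s.1, fun hs => s.2 (hs.trans_le hc)⟩
  have hbot : ∀ a : Top q L₁ L₂ c, (fun s : {s : Site L₁ L₂ // ¬ s.1.val < c'} =>
      glue (fun s : Site L₁ L₂ => s.1.val < c) a b s.1) = bb := by
    intro a
    funext s
    simp [glue, bb, not_lt.2 (hc.trans (not_lt.1 s.2))]
  simp only [CutTruncation.result, hbot, Finset.mul_sum]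
  rw [Finset.sum_comm]
  refine Finset.sum_eq_zero fun k _ => ?_
  by_cases hk : k.val < T.kept
  · simp only [hk, if_true]
    calc _ = T.bot k bb * ∑ a, star (u a) * ((T.sv k : ℂ) * T.top k (fun s =>
            glue (fun s : Site L₁ L₂ => s.1.val < c) a b s.1)) := by
          rw [Finset.mul_sum]
          exact Finset.sum_congr rfl fun a _ => by ring
      _ = 0 := by
          simp_rw [← T.sum_star_bot_mul, Finset.mul_sum]
          rw [Finset.sum_comm]
          refine Finset.sum_eq_zero fun y _ => ?_
          -- The rows from `c'` on of `b` are overwritten by `y`.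
          have h' := h fun s => if hs : s.1.1.val < c' then b s else y ⟨s.1, hs⟩
          calc _ = T.bot k bb * (star (T.bot k y) * ∑ a, star (u a) *
                φ (glue (fun s : Site L₁ L₂ => s.1.val < c) a
                  fun s => if hs : s.1.1.val < c' then b s else y ⟨s.1, hs⟩)) := by
                rw [Finset.mul_sum, Finset.mul_sum]
                refine Finset.sum_congr rfl fun a _ => ?_
                have : glue (fun s : Site L₁ L₂ => s.1.val < c') (fun s =>
                    glue (fun s : Site L₁ L₂ => s.1.val < c) a b s.1) y =
                    glue (fun s : Site L₁ L₂ => s.1.val < c) a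
                      fun s => if hs : s.1.1.val < c' then b s else y ⟨s.1, hs⟩ := by
                  funext s
                  simp only [glue]
                  split_ifs <;> first | rfl | omega
                rw [this]
                ring
            _ = 0 := by rw [h', mul_zero, mul_zero]
  · simp [hk]

theorem TopOrthogonal.sweep_result {ε : ℝ} {c : ℕ} {u : EuclideanSpace ℂ (Top q L₁ L₂ c)} :
    ∀ {cs : List ℕ} {φ : State q L₁ L₂} (S : Sweep ε cs φ), (∀ c' ∈ cs, c ≤ c') →
      TopOrthogonal c u φ → TopOrthogonal c u S.result
  | _, _, .nil _, _, h => h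
  | _, _, .cons T rest, hcs, h =>
    TopOrthogonal.sweep_result rest (fun c' hc' => hcs c' (List.mem_cons_of_mem _ hc'))
      (h.result (hcs _ List.mem_cons_self) T)

/-- What a truncation discards is orthogonal to every state that is obtained afterwards in a sweep
over later cuts. -/
theorem CutTruncation.inner_sub_result {ε : ℝ} {c : ℕ} {ψ : State q L₁ L₂}
    (T : CutTruncation ε c ψ) {cs : List ℕ} (S : Sweep ε cs T.result) (hcs : ∀ c' ∈ cs, c ≤ c') :
    inner ℂ (ψ - T.result) S.result = 0 := by
  rw [T.sub_result_eq_sum, sum_inner]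
  refine Finset.sum_eq_zero fun k _ => ?_
  rw [inner_smul_left]
  by_cases hk : T.kept ≤ k.val
  · rw [((T.topOrthogonal_result hk).sweep_result S hcs).inner_eq_zero, mul_zero]
  · simp [hk]

theorem CutTruncation.norm_result_sq {ε : ℝ} {c : ℕ} {ψ : State q L₁ L₂}
    (T : CutTruncation ε c ψ) : ‖T.result‖ ^ 2 = ‖ψ‖ ^ 2 - T.tailSq T.kept := by
  have h := T.inner_sub_result (.nil _) (by simp)
  have h2 := norm_add_sq_eq_norm_sq_add_norm_sq_of_inner_eq_zero _ _ h
  rw [Sweep.result, sub_add_cancel] at h2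
  rw [← T.norm_sub_result_sq]
  linarith

theorem CutTruncation.result_ne_zero {ε : ℝ} {c : ℕ} {ψ : State q L₁ L₂}
    (T : CutTruncation ε c ψ) (hψ : ψ ≠ 0) : T.result ≠ 0 := by
  have hr : 0 < T.rank := by
    rcases Nat.eq_zero_or_pos T.rank with h | h
    · refine absurd ?_ hψ
      rw [T.toSchmidt.eq_sum]
      have : IsEmpty (Fin T.rank) := by rw [h]; infer_instance
      simp
    · exact h
  intro h0
  have h1 := T.orthonormal_cutProduct.inner_right_fintype
    (fun k => if k.val < T.kept then (T.sv k : ℂ) else 0) ⟨0, hr⟩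
  rw [← T.result_eq_sum, h0, inner_zero_right, if_pos (T.kept_pos hr)] at h1
  exact (T.sv_pos ⟨0, hr⟩).ne' (by exact_mod_cast h1.symm)

theorem Sweep.result_ne_zero {ε : ℝ} : ∀ {cs : List ℕ} {ψ : State q L₁ L₂} (S : Sweep ε cs ψ),
    ψ ≠ 0 → S.result ≠ 0
  | _, _, .nil _, h => h
  | _, _, .cons T rest, h => rest.result_ne_zero (T.result_ne_zero h)

theorem Sweep.norm_result_sq {ε : ℝ} : ∀ {cs : List ℕ} {ψ : State q L₁ L₂} (S : Sweep ε cs ψ),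
    ‖S.result‖ ^ 2 = ‖ψ‖ ^ 2 - S.discardedSq
  | _, _, .nil _ => by simp [Sweep.result, Sweep.discardedSq]
  | _, _, .cons T rest => by
    rw [Sweep.result, Sweep.discardedSq, rest.norm_result_sq, T.norm_result_sq]
    ring

/-- A sweep over increasing cuts is a single orthogonal projection as far as the overlap with the
initial state is concerned. -/
theorem Sweep.inner_result {ε : ℝ} : ∀ {cs : List ℕ} {ψ : State q L₁ L₂} (S : Sweep ε cs ψ),
    cs.Pairwise (· ≤ ·) → inner ℂ ψ S.result = ((‖S.result‖ ^ 2 : ℝ) : ℂ)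
  | _, _, .nil ψ, _ => by
    simp [Sweep.result]
  | _, ψ, .cons T rest, hcs => by
    rw [List.pairwise_cons] at hcs
    rw [Sweep.result, ← rest.inner_result hcs.2, ← sub_eq_zero, ← inner_sub_left]
    exact T.inner_sub_result rest hcs.1

theorem Schmidt.tailSq_nonneg {c : ℕ} {ψ : State q L₁ L₂} (S : Schmidt c ψ) (r : ℕ) :
    0 ≤ S.tailSq r :=
  Finset.sum_nonneg fun k _ => by split_ifs <;> positivity

theorem Schmidt.tailSum_nonneg {c : ℕ} {ψ : State q L₁ L₂} (S : Schmidt c ψ) (r : ℕ) :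
    0 ≤ S.tailSum r :=
  Finset.sum_nonneg fun k _ => by
    split_ifs
    exacts [(S.sv_pos k).le, le_rfl]

theorem Schmidt.tailSq_le_tailSum_sq {c : ℕ} {ψ : State q L₁ L₂} (S : Schmidt c ψ) (r : ℕ) :
    S.tailSq r ≤ S.tailSum r ^ 2 := by
  have h := Finset.sum_sq_le_sq_sum_of_nonneg (s := Finset.univ)
    (f := fun k => if r ≤ k.val then S.sv k else 0) fun k _ => by
      split_ifs
      exacts [(S.sv_pos k).le, le_rfl]
  refine le_of_eq_of_le (Finset.sum_congr rfl fun k _ => ?_) h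
  split_ifs <;> simp

theorem Sweep.discardedSum_nonneg {ε : ℝ} : ∀ {cs : List ℕ} {ψ : State q L₁ L₂}
    (S : Sweep ε cs ψ), 0 ≤ S.discardedSum
  | _, _, .nil _ => le_rfl
  | _, _, .cons T rest => add_nonneg (T.tailSum_nonneg _) rest.discardedSum_nonneg

theorem Sweep.discardedSq_nonneg {ε : ℝ} : ∀ {cs : List ℕ} {ψ : State q L₁ L₂}
    (S : Sweep ε cs ψ), 0 ≤ S.discardedSq
  | _, _, .nil _ => le_rfl
  | _, _, .cons T rest => add_nonneg (T.tailSq_nonneg _) rest.discardedSq_nonneg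

theorem Sweep.discardedSq_le {ε : ℝ} : ∀ {cs : List ℕ} {ψ : State q L₁ L₂}
    (S : Sweep ε cs ψ), S.discardedSq ≤ S.discardedSum ^ 2
  | _, _, .nil _ => by simp [Sweep.discardedSq, Sweep.discardedSum]
  | _, _, .cons T rest => by
    rw [Sweep.discardedSq, Sweep.discardedSum]
    have h1 := T.tailSq_le_tailSum_sq T.kept
    have h2 := rest.discardedSq_le
    have h3 := mul_nonneg (T.tailSum_nonneg T.kept) rest.discardedSum_nonneg
    nlinarith

theorem norm_normalize {ψ : State q L₁ L₂} (hψ : ψ ≠ 0) : ‖normalize ψ‖ = 1 := by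
  rw [normalize, norm_smul, Complex.norm_real, norm_inv, norm_norm,
    inv_mul_cancel₀ (norm_ne_zero_iff.2 hψ)]

theorem norm_smul_normalize (ψ : State q L₁ L₂) : (‖ψ‖ : ℂ) • normalize ψ = ψ := by
  by_cases hψ : ψ = 0
  · simp [hψ]
  · have : (‖ψ‖ : ℂ) ≠ 0 := by exact_mod_cast norm_ne_zero_iff.2 hψ
    rw [normalize, smul_smul, Complex.ofReal_inv, mul_inv_cancel₀ this, one_smul]

/-- The compression of a unit vector moves it by at most `√(2δ)`, where `δ` is the sum of the squares
of all discarded singular values. -/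
theorem Compression.norm_sub_normalize_le {ε : ℝ} {ψ : State q L₁ L₂} (S : Compression ε ψ)
    (hψ : ‖ψ‖ = 1) : ‖ψ - normalize S.result‖ ≤ √(2 * S.discardedSq) := by
  have h0 : ψ ≠ 0 := fun h => by simp [h] at hψ
  have hr : 0 < ‖S.result‖ := norm_pos_iff.2 (S.result_ne_zero h0)
  have h1 := S.norm_result_sq
  rw [hψ] at h1
  have h2 : RCLike.re (inner ℂ ψ (normalize S.result)) = ‖S.result‖ := by
    rw [normalize, inner_smul_right, S.inner_result (List.pairwise_le_range' ..),
      ← Complex.ofReal_mul, sq, inv_mul_cancel_left₀ hr.ne']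
    exact Complex.ofReal_re _
  refine Real.le_sqrt_of_sq_le ?_
  rw [norm_sub_sq (𝕜 := ℂ), h2, hψ, norm_normalize (S.result_ne_zero h0)]
  -- With `r` the norm of the truncated state, `2 - 2r ≤ 2 (1 - r²)` because `0 ≤ r ≤ 1`.
  have h3 : ‖S.result‖ ≤ 1 := by nlinarith [S.discardedSq_nonneg]
  nlinarith

/-! ### Gates -/

namespace Gate

/-- The configuration `x`, overwritten by `y` on the support of the gate. -/
def overwrite (g : Gate q L₁ L₂) (x : Config q L₁ L₂) (y : g.support → Fin q) : Config q L₁ L₂ :=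
  fun s => if h : s ∈ g.support then y ⟨s, h⟩ else x s

theorem apply_apply (g : Gate q L₁ L₂) (ψ : State q L₁ L₂) (x : Config q L₁ L₂) :
    g.apply ψ x = ∑ y, g.op.1 (fun s => x s.1) y * ψ (g.overwrite x y) := rfl

theorem overwrite_of_notMem (g : Gate q L₁ L₂) (x : Config q L₁ L₂) (y : g.support → Fin q)
    {s : Site L₁ L₂} (hs : s ∉ g.support) : g.overwrite x y s = x s := dif_neg hs

theorem apply_sub (g : Gate q L₁ L₂) (ψ φ : State q L₁ L₂) :
    g.apply (ψ - φ) = g.apply ψ - g.apply φ := by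
  ext x
  simp [apply_apply, mul_sub]

theorem apply_smul (g : Gate q L₁ L₂) (z : ℂ) (ψ : State q L₁ L₂) :
    g.apply (z • ψ) = z • g.apply ψ := by
  ext x
  simp only [apply_apply, PiLp.smul_apply, smul_eq_mul, Finset.mul_sum]
  exact Finset.sum_congr rfl fun y _ => by ring

theorem norm_apply (g : Gate q L₁ L₂) (ψ : State q L₁ L₂) : ‖g.apply ψ‖ = ‖ψ‖ := by
  rw [← sq_eq_sq₀ (norm_nonneg _) (norm_nonneg _), norm_sq_state, norm_sq_state,
    sum_glue (fun s => s ∈ g.support), sum_glue (fun s => s ∈ g.support), Finset.sum_comm]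
  conv_rhs => rw [Finset.sum_comm]
  refine Finset.sum_congr rfl fun b _ => ?_
  let v : EuclideanSpace ℂ (g.support → Fin q) :=
    WithLp.toLp 2 fun y => ψ (glue (fun s => s ∈ g.support) y b)
  have h1 := EuclideanSpace.norm_sq_eq (Matrix.toEuclideanCLM (𝕜 := ℂ) g.op.1 v)
  have h2 := EuclideanSpace.norm_sq_eq v
  have h3 : ‖Matrix.toEuclideanCLM (𝕜 := ℂ) g.op.1 v‖ = ‖v‖ := by
    have hu : Matrix.toEuclideanCLM (𝕜 := ℂ) (n := g.support → Fin q) g.op.1 ∈ unitary _ :=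
      Unitary.map_mem (Matrix.toEuclideanCLM (𝕜 := ℂ)) g.op.2
    exact ContinuousLinearMap.norm_map_of_mem_unitary hu v
  rw [h3, h2] at h1
  refine Eq.trans ?_ h1.symm
  refine Finset.sum_congr rfl fun a _ => ?_
  congr 2
  rw [apply_apply, Matrix.ofLp_toEuclideanCLM, Matrix.mulVec, dotProduct]
  refine Finset.sum_congr rfl fun y _ => ?_
  simp only [glue_pos]
  refine congrArg (_ * ψ.ofLp ·) (funext fun s => ?_)
  by_cases hs : s ∈ g.support <;> simp [overwrite, glue, hs]

theorem apply_comm {g g' : Gate q L₁ L₂} (h : Disjoint g.support g'.support)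
    (ψ : State q L₁ L₂) : g.apply (g'.apply ψ) = g'.apply (g.apply ψ) := by
  have key : ∀ (g g' : Gate q L₁ L₂), Disjoint g.support g'.support → ∀ x : Config q L₁ L₂,
      g.apply (g'.apply ψ) x = ∑ y, ∑ y', g.op.1 (fun s => x s.1) y *
        (g'.op.1 (fun s => x s.1) y' * ψ (g'.overwrite (g.overwrite x y) y')) := by
    intro g g' h x
    simp only [apply_apply, Finset.mul_sum]
    refine Finset.sum_congr rfl fun y _ => Finset.sum_congr rfl fun y' _ => ?_
    have : (fun s : g'.support => g.overwrite x y s.1) = fun s => x s.1 :=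
      funext fun s => g.overwrite_of_notMem x y (Finset.disjoint_right.1 h s.2)
    rw [this]
  ext x
  rw [key g g' h x, key g' g h.symm x, Finset.sum_comm]
  refine Finset.sum_congr rfl fun y' _ => Finset.sum_congr rfl fun y _ => ?_
  have : g'.overwrite (g.overwrite x y) y' = g.overwrite (g'.overwrite x y') y := by
    funext s
    by_cases hs : s ∈ g.support
    · simp [overwrite, hs, Finset.disjoint_left.1 h hs]
    · simp [overwrite, hs]
  rw [this]
  ring

end Gate

/-! ### Sequences of gates -/

/-- Apply the gates of a list, in the order of the list. -/
def applyList (l : List (Gate q L₁ L₂)) (ψ : State q L₁ L₂) : State q L₁ L₂ :=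
  l.foldl (fun φ g => g.apply φ) ψ

theorem applyList_sub (l : List (Gate q L₁ L₂)) (ψ φ : State q L₁ L₂) :
    applyList l (ψ - φ) = applyList l ψ - applyList l φ := by
  induction l generalizing ψ φ with
  | nil => rfl
  | cons g l ih => exact (congrArg (applyList l) (g.apply_sub ψ φ)).trans (ih _ _)

theorem applyList_smul (l : List (Gate q L₁ L₂)) (z : ℂ) (ψ : State q L₁ L₂) :
    applyList l (z • ψ) = z • applyList l ψ := by
  induction l generalizing ψ with
  | nil => rfl
  | cons g l ih => exact (congrArg (applyList l) (g.apply_smul z ψ)).trans (ih _)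

theorem norm_applyList (l : List (Gate q L₁ L₂)) (ψ : State q L₁ L₂) :
    ‖applyList l ψ‖ = ‖ψ‖ := by
  induction l generalizing ψ with
  | nil => rfl
  | cons g l ih => exact (ih _).trans (g.norm_apply ψ)

/-- An operation that commutes with every gate of a list commutes with the whole list. -/
theorem applyList_comm (l : List (Gate q L₁ L₂)) {A : State q L₁ L₂ → State q L₁ L₂}
    (h : ∀ g ∈ l, ∀ ψ, g.apply (A ψ) = A (g.apply ψ)) (ψ : State q L₁ L₂) :
    applyList l (A ψ) = A (applyList l ψ) := by
  induction l generalizing ψ with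
  | nil => rfl
  | cons g l ih =>
    refine (congrArg (applyList l) (h g List.mem_cons_self ψ)).trans ?_
    exact ih (fun g' hg' => h g' (List.mem_cons_of_mem _ hg')) _

namespace Circuit

variable (C : Circuit q L₁ L₂)

open Classical in
theorem applyGates_eq_applyList (p : Fin C.size → Prop) (ψ : State q L₁ L₂) :
    C.applyGates p ψ =
      applyList (((List.finRange C.size).filter fun i => decide (p i)).map C.gate) ψ := by
  rw [applyList, List.foldl_map]
  rfl

theorem applyGates_comm {p : Fin C.size → Prop} {A : State q L₁ L₂ → State q L₁ L₂}
    (h : ∀ i, p i → ∀ ψ, (C.gate i).apply (A ψ) = A ((C.gate i).apply ψ)) (ψ : State q L₁ L₂) :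
    C.applyGates p (A ψ) = A (C.applyGates p ψ) := by
  simp only [applyGates_eq_applyList]
  refine applyList_comm _ (fun g hg => ?_) ψ
  obtain ⟨i, hi, rfl⟩ := List.mem_map.1 hg
  exact h i (by simpa using (List.mem_filter.1 hi).2)

/-- Two disjoint classes of gates may be performed one after the other if every gate of the second
class commutes with the later gates of the first class. -/
theorem applyGates_or {p r : Fin C.size → Prop} (hpr : ∀ i, p i → ¬ r i)
    (h : ∀ i j, i < j → r i → p j → Disjoint (C.gate i).support (C.gate j).support)
    (ψ : State q L₁ L₂) :
    C.applyGates (fun i => p i ∨ r i) ψ = C.applyGates r (C.applyGates p ψ) := by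
  classical
  simp only [applyGates_eq_applyList]
  have hl : (List.finRange C.size).Pairwise (· < ·) := List.pairwise_lt_finRange _
  generalize List.finRange C.size = l at hl
  induction l generalizing ψ with
  | nil => rfl
  | cons i l ih =>
    replace ih := fun ψ => ih ψ hl.of_cons
    rw [List.pairwise_cons] at hl
    by_cases hp : p i
    · have hr : ¬ r i := hpr i hp
      simp only [List.filter_cons, hp, hr, true_or, decide_true, decide_false, if_true,
        List.map_cons]
      exact ih _
    · by_cases hr : r i
      · simp only [List.filter_cons, hp, hr, or_true, decide_true, decide_false, if_true,
          List.map_cons]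
        refine (ih _).trans ?_
        refine congrArg (applyList ((l.filter fun i => decide (r i)).map C.gate)) ?_
        refine applyList_comm _ (A := (C.gate i).apply) (fun g hg φ => ?_) ψ
        obtain ⟨j, hj, rfl⟩ := List.mem_map.1 hg
        obtain ⟨hj, hpj⟩ := List.mem_filter.1 hj
        exact Gate.apply_comm (h i j (hl.1 j hj) hr (of_decide_eq_true hpj)).symm φ
      · simp only [List.filter_cons, hp, hr, or_self, decide_false]
        exact ih _

theorem applyV_sub (t : ℕ) (ψ φ : State q L₁ L₂) :
    C.applyV t (ψ - φ) = C.applyV t ψ - C.applyV t φ := by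
  simp only [applyV, applyGates_eq_applyList, applyList_sub]

theorem applyV_smul (t : ℕ) (z : ℂ) (ψ : State q L₁ L₂) :
    C.applyV t (z • ψ) = z • C.applyV t ψ := by
  simp only [applyV, applyGates_eq_applyList, applyList_smul]

theorem norm_applyV (t : ℕ) (ψ : State q L₁ L₂) : ‖C.applyV t ψ‖ = ‖ψ‖ := by
  rw [applyV, applyGates_eq_applyList, norm_applyList]

end Circuit

/-! ### Projections onto measurement outcomes -/

theorem projectColumn_apply (t : ℕ) (a : Column q L₁) (ψ : State q L₁ L₂) (x : Config q L₁ L₂)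
    [Decidable (∀ s : Site L₁ L₂, s.2.val = t → x s = a s.1)] :
    projectColumn t a ψ x = if ∀ s : Site L₁ L₂, s.2.val = t → x s = a s.1 then ψ x else 0 := by
  simp only [projectColumn]
  congr

theorem projectColumn_sub (t : ℕ) (a : Column q L₁) (ψ φ : State q L₁ L₂) :
    projectColumn t a (ψ - φ) = projectColumn t a ψ - projectColumn t a φ := by
  classical
  ext x
  simp only [projectColumn_apply, PiLp.sub_apply]
  split_ifs <;> simp

theorem projectColumn_smul (t : ℕ) (a : Column q L₁) (z : ℂ) (ψ : State q L₁ L₂) :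
    projectColumn t a (z • ψ) = z • projectColumn t a ψ := by
  classical
  ext x
  simp only [projectColumn_apply, PiLp.smul_apply]
  split_ifs <;> simp

/-- The outcome probabilities of the measurement of a column add up to one. -/
theorem sum_norm_projectColumn_sq {t : ℕ} (ht : t < L₂) (ψ : State q L₁ L₂) :
    ∑ a, ‖projectColumn t a ψ‖ ^ 2 = ‖ψ‖ ^ 2 := by
  classical
  simp only [norm_sq_state]
  rw [Finset.sum_comm]
  refine Finset.sum_congr rfl fun x _ => ?_
  -- Only the outcome that agrees with `x` on column `t` contributes.
  rw [Finset.sum_eq_single fun i => x (i, ⟨t, ht⟩)]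
  · rw [projectColumn_apply, if_pos]
    rintro ⟨i, j⟩ rfl
    rfl
  · intro a _ ha
    rw [projectColumn_apply, if_neg]
    · simp
    · exact fun h => ha (funext fun i => (h (i, ⟨t, ht⟩) rfl).symm)
  · simp

/-! ### The exact process, measured column by column -/

namespace Circuit

variable (C : Circuit q L₁ L₂)

/-- The unnormalized state that results from `ψ` when, for the columns `t, t + 1, …` in turn, the
new gates of the lightcone are applied and the column is projected onto its outcome in the list,
without any compression. -/
noncomputable def exactRun : ℕ → List (Column q L₁) → State q L₁ L₂ → State q L₁ L₂
  | _, [], ψ => ψ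
  | t, a :: y, ψ => exactRun (t + 1) y (projectColumn t a (C.applyV t ψ))

theorem exactRun_sub (t : ℕ) (y : List (Column q L₁)) (ψ φ : State q L₁ L₂) :
    C.exactRun t y (ψ - φ) = C.exactRun t y ψ - C.exactRun t y φ := by
  induction y generalizing t ψ φ with
  | nil => rfl
  | cons a y ih => simp only [exactRun, applyV_sub, projectColumn_sub, ih]

theorem exactRun_smul (t : ℕ) (y : List (Column q L₁)) (z : ℂ) (ψ : State q L₁ L₂) :
    C.exactRun t y (z • ψ) = z • C.exactRun t y ψ := by
  induction y generalizing t ψ with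
  | nil => rfl
  | cons a y ih => simp only [exactRun, applyV_smul, projectColumn_smul, ih]

theorem exactRun_concat (t : ℕ) (y : List (Column q L₁)) (a : Column q L₁) (ψ : State q L₁ L₂) :
    C.exactRun t (y ++ [a]) ψ =
      projectColumn (t + y.length) a (C.applyV (t + y.length) (C.exactRun t y ψ)) := by
  induction y generalizing t ψ with
  | nil => rfl
  | cons b y ih =>
    rw [List.cons_append, exactRun, ih, exactRun, List.length_cons, Nat.add_right_comm,
      Nat.add_assoc t]

end Circuit

theorem sum_ofFn_succ {α M : Type*} [Fintype α] [AddCommMonoid M] {n : ℕ} (F : List α → M) :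
    ∑ y : Fin (n + 1) → α, F (List.ofFn y) =
      ∑ a, ∑ y : Fin n → α, F (a :: List.ofFn y) := by
  rw [← Fintype.sum_prod_type' (f := fun a (y : Fin n → α) => F (a :: List.ofFn y))]
  refine (Fintype.sum_equiv (Fin.consEquiv fun _ => α) _ _ fun p => ?_).symm
  simp [Fin.consEquiv, List.ofFn_succ]

namespace Circuit

variable (C : Circuit q L₁ L₂)

theorem sum_norm_exactRun_sq {n t : ℕ} (hn : t + n ≤ L₂) (ψ : State q L₁ L₂) :
    ∑ y : Fin n → Column q L₁, ‖C.exactRun t (List.ofFn y) ψ‖ ^ 2 = ‖ψ‖ ^ 2 := by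
  induction n generalizing t ψ with
  | zero => simp [exactRun]
  | succ n ih =>
    rw [sum_ofFn_succ fun y => ‖C.exactRun t y ψ‖ ^ 2]
    simp only [exactRun]
    rw [Finset.sum_congr rfl fun a _ => ih (t := t + 1) (by omega) _,
      sum_norm_projectColumn_sq (by omega), C.norm_applyV]

/-- The distributions of the measurement outcomes of two unit vectors are at most as far apart as
twice the distance of the vectors. -/
theorem sum_abs_norm_exactRun_sq_sub_le {n t : ℕ} (hn : t + n ≤ L₂) {ψ φ : State q L₁ L₂}
    (hψ : ‖ψ‖ = 1) (hφ : ‖φ‖ = 1) :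
    ∑ y : Fin n → Column q L₁,
      |‖C.exactRun t (List.ofFn y) ψ‖ ^ 2 - ‖C.exactRun t (List.ofFn y) φ‖ ^ 2| ≤
        2 * ‖ψ - φ‖ := by
  have key : ∀ χ : State q L₁ L₂, ‖χ‖ = 1 → ∑ y : Fin n → Column q L₁,
      ‖C.exactRun t (List.ofFn y) (ψ - φ)‖ * ‖C.exactRun t (List.ofFn y) χ‖ ≤ ‖ψ - φ‖ := by
    intro χ hχ
    refine (Real.sum_mul_le_sqrt_mul_sqrt _ _ _).trans_eq ?_
    rw [C.sum_norm_exactRun_sq hn, C.sum_norm_exactRun_sq hn, hχ, one_pow, Real.sqrt_one, mul_one,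
      Real.sqrt_sq (norm_nonneg _)]
  calc _ ≤ ∑ y : Fin n → Column q L₁,
        (‖C.exactRun t (List.ofFn y) (ψ - φ)‖ * ‖C.exactRun t (List.ofFn y) ψ‖ +
          ‖C.exactRun t (List.ofFn y) (ψ - φ)‖ * ‖C.exactRun t (List.ofFn y) φ‖) := by
        refine Finset.sum_le_sum fun y _ => ?_
        rw [C.exactRun_sub, sq_sub_sq, abs_mul, abs_of_nonneg (by positivity), ← mul_add, mul_comm]
        exact mul_le_mul_of_nonneg_right (abs_norm_sub_norm_le _ _) (by positivity)
    _ ≤ 2 * ‖ψ - φ‖ := by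
        rw [Finset.sum_add_distrib]
        linarith [key ψ hψ, key φ hφ]

end Circuit

/-! ### The exact process samples the output distribution of the circuit -/

/-- The projection onto the configurations that agree with `x` at all sites satisfying `p`. -/
noncomputable def projectOn (p : Site L₁ L₂ → Prop) (x : Config q L₁ L₂) (ψ : State q L₁ L₂) :
    State q L₁ L₂ :=
  open Classical in
  WithLp.toLp 2 fun z => if ∀ s, p s → z s = x s then ψ z else 0

theorem projectColumn_eq_projectOn (x : Config q L₁ L₂) (j : Fin L₂) (ψ : State q L₁ L₂) :
    projectColumn j.val (fun i => x (i, j)) ψ = projectOn (fun s => s.2.val = j.val) x ψ := by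
  have h : ∀ z : Config q L₁ L₂, (∀ s : Site L₁ L₂, s.2.val = j.val → z s = x (s.1, j)) ↔
      ∀ s : Site L₁ L₂, s.2.val = j.val → z s = x s := by
    refine fun z => forall_congr' fun s => forall_congr' fun hs => ?_
    rw [← Fin.ext hs]
  simp only [projectColumn, projectOn, h]

theorem projectOn_projectOn (p r : Site L₁ L₂ → Prop) (x : Config q L₁ L₂) (ψ : State q L₁ L₂) :
    projectOn p x (projectOn r x ψ) = projectOn (fun s => r s ∨ p s) x ψ := by
  classical
  ext z
  have h : (∀ s, r s ∨ p s → z s = x s) ↔ (∀ s, p s → z s = x s) ∧ ∀ s, r s → z s = x s := by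
    simp only [or_imp, forall_and, and_comm]
  simp only [projectOn, h, ite_and]

theorem Gate.apply_projectOn {g : Gate q L₁ L₂} {p : Site L₁ L₂ → Prop}
    (h : ∀ s ∈ g.support, ¬ p s) (x : Config q L₁ L₂) (ψ : State q L₁ L₂) :
    g.apply (projectOn p x ψ) = projectOn p x (g.apply ψ) := by
  classical
  ext z
  have hiff : ∀ y, (∀ s, p s → g.overwrite z y s = x s) ↔ ∀ s, p s → z s = x s :=
    fun y => forall_congr' fun s => forall_congr' fun hs => by
      rw [g.overwrite_of_notMem z y fun hs' => h s hs' hs]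
  simp only [Gate.apply_apply, projectOn, hiff]
  split_ifs <;> simp

namespace Circuit

variable (C : Circuit q L₁ L₂)

theorem exists_inLightcone (i : Fin C.size) : ∃ t < L₂, C.InLightcone t i := by
  have : ∃ s, s ∈ (C.gate i).support := by
    rcases (C.gate i).isLocal with ⟨a, ha⟩ | ⟨a, b, -, hab⟩
    · exact ⟨a, by simp [ha]⟩
    · exact ⟨a, by simp [hab]⟩
  obtain ⟨s, hs⟩ := this
  exact ⟨s.2.val, s.2.isLt, .base i s hs rfl⟩

/-- Performing `V_t` after all gates in the lightcones of the earlier columns performs the gates in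
the lightcones of the columns up to `t`: a gate of `V_t` overlaps no later gate which is in the
lightcone of an earlier column. -/
theorem applyV_applyGates (t : ℕ) (ψ : State q L₁ L₂) :
    C.applyV t (C.applyGates (fun i => ∃ t' < t, C.InLightcone t' i) ψ) =
      C.applyGates (fun i => ∃ t' < t + 1, C.InLightcone t' i) ψ := by
  rw [applyV, ← C.applyGates_or]
  · congr 1
    funext i
    refine propext ⟨?_, ?_⟩
    · rintro (⟨t', ht', h⟩ | ⟨h, -⟩)
      exacts [⟨t', by omega, h⟩, ⟨t, by omega, h⟩]
    · rintro ⟨t', ht', h⟩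
      by_cases hp : ∃ t' < t, C.InLightcone t' i
      · exact Or.inl hp
      · have : t' = t := by
          by_contra hne
          exact hp ⟨t', by omega, h⟩
        exact Or.inr ⟨this ▸ h, fun t' ht' h' => hp ⟨t', ht', h'⟩⟩
  · rintro i ⟨t', ht', h⟩ ⟨-, h'⟩
    exact h' t' ht' h
  · rintro i j hij ⟨-, h⟩ ⟨t', ht', hj⟩
    by_contra hd
    exact h t' ht' (.step i j hij hd hj)

/-- The gates of `V_t` do not act on the columns before `t`, so they commute with the projections of
these columns. -/
theorem applyV_projectOn (t : ℕ) (x : Config q L₁ L₂) (ψ : State q L₁ L₂) :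
    C.applyV t (projectOn (fun s => s.2.val < t) x ψ) =
      projectOn (fun s => s.2.val < t) x (C.applyV t ψ) :=
  C.applyGates_comm (fun i hi => (C.gate i).apply_projectOn
    (fun s hs hst => hi.2 s.2.val hst (.base i s hs rfl)) x) ψ

theorem exactRun_take (x : Config q L₁ L₂) (ψ : State q L₁ L₂) {t : ℕ} (ht : t ≤ L₂) :
    C.exactRun 0 ((List.ofFn fun j i => x (i, j)).take t) ψ =
      projectOn (fun s => s.2.val < t) x
        (C.applyGates (fun i => ∃ t' < t, C.InLightcone t' i) ψ) := by
  induction t with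
  | zero => simp [exactRun, applyGates, projectOn]
  | succ t ih =>
    have htl : t < (List.ofFn fun (j : Fin L₂) i => x (i, j)).length := by simpa using ht
    rw [← List.take_append_getElem htl, exactRun_concat, ih (by omega),
      List.length_take_of_le htl.le, Nat.zero_add, applyV_projectOn, applyV_applyGates, List.getElem_ofFn,
      projectColumn_eq_projectOn x ⟨t, ht⟩, projectOn_projectOn]
    congr 1
    funext s
    exact propext Nat.lt_succ_iff_lt_or_eq.symm

/-- The exact process yields the string `x` with the probability with which the circuit does. -/
theorem norm_exactRun_sq [NeZero q] (x : Config q L₁ L₂) :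
    ‖C.exactRun 0 (List.ofFn fun j i => x (i, j)) (initialState q L₁ L₂)‖ ^ 2 =
      C.outputProb x := by
  classical
  have h := C.exactRun_take x (initialState q L₁ L₂) le_rfl
  rw [List.take_of_length_le (by simp)] at h
  have hall : (fun i => ∃ t' < L₂, C.InLightcone t' i) = fun _ => True :=
    funext fun i => eq_true (C.exists_inLightcone i)
  rw [h, hall, norm_sq_state, Finset.sum_eq_single x]
  · simp [projectOn, outputProb]
  · intro z _ hz
    have : ¬ ∀ s : Site L₁ L₂, s.2.val < L₂ → z s = x s :=
      fun h => hz (funext fun s => h s s.2.isLt)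
    simp only [projectOn, if_neg this]
    simp
  · simp

end Circuit

/-! ### The algorithm against the exact process -/

theorem history_eq (x : Config q L₁ L₂) (t : ℕ) :
    history x t = ((List.ofFn fun j i => x (i, j)).take t).reverse := by
  rw [history, List.map_reverse, List.map_take, List.ofFn_eq_map]

section Algorithm

variable [NeZero q] {ε : ℝ} (C : Circuit q L₁ L₂) (T : Compressor q L₁ L₂ ε)

/-- The probability with which the algorithm, after the column outcomes `h` (latest first), samples
the outcomes `y` (earliest first) for the following columns. -/
noncomputable def tailProb (h : List (Column q L₁)) : List (Column q L₁) → ℝ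
  | [] => 1
  | a :: y => condProb C T h a * tailProb (a :: h) y

/-- The quantity `√(2 εᵢ)` for the compression that follows the column outcomes `h`. -/
noncomputable def stepError (h : List (Column q L₁)) : ℝ :=
  √(2 * (compressionAt C T h).discardedSq)

/-- The sum of `√(2 εᵢ)` over the iterations in which the outcomes `y` (earliest first) are sampled
after the column outcomes `h` (latest first). -/
noncomputable def tailError (h : List (Column q L₁)) : List (Column q L₁) → ℝ
  | [] => 0
  | a :: y => stepError C T h + tailError (a :: h) y

theorem condProb_nonneg (h : List (Column q L₁)) (a : Column q L₁) : 0 ≤ condProb C T h a :=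
  sq_nonneg _

theorem tailProb_ofFn {n : ℕ} (h : List (Column q L₁)) (y : Fin n → Column q L₁) :
    tailProb C T h (List.ofFn y) =
      ∏ t : Fin n, condProb C T (((List.ofFn y).take t).reverse ++ h) (y t) := by
  induction n generalizing h with
  | zero => simp [tailProb]
  | succ n ih => simp [List.ofFn_succ, tailProb, ih, Fin.prod_univ_succ]

theorem tailError_ofFn {n : ℕ} (h : List (Column q L₁)) (y : Fin n → Column q L₁) :
    tailError C T h (List.ofFn y) =
      ∑ t : Fin n, stepError C T (((List.ofFn y).take t).reverse ++ h) := by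
  induction n generalizing h with
  | zero => simp [tailError]
  | succ n ih => simp [List.ofFn_succ, tailError, ih, Fin.sum_univ_succ]

theorem tailProb_eq_sampleProb (x : Config q L₁ L₂) :
    tailProb C T [] (List.ofFn fun j i => x (i, j)) = sampleProb C T x := by
  simp only [tailProb_ofFn, List.append_nil, sampleProb, history_eq]

theorem tailError_eq (x : Config q L₁ L₂) :
    tailError C T [] (List.ofFn fun j i => x (i, j)) = ∑ t, √(2 * truncError C T x t) := by
  simp only [tailError_ofFn, List.append_nil, ← history_eq]
  rfl

variable {C T}

theorem norm_stateBefore_cons {h : List (Column q L₁)} {a : Column q L₁}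
    (ha : condProb C T h a ≠ 0) : ‖stateBefore C T (a :: h)‖ = 1 := by
  refine norm_normalize fun h0 => ha ?_
  rw [condProb, compressionAt, h0]
  simp

theorem norm_normalize_compressionAt {h : List (Column q L₁)} (hh : ‖stateBefore C T h‖ = 1) :
    ‖normalize (compressionAt C T h).result‖ = 1 :=
  norm_normalize (Sweep.result_ne_zero _ fun h0 => by simp [h0] at hh)

theorem sum_condProb {h : List (Column q L₁)} (hh : ‖stateBefore C T h‖ = 1)
    (hlt : h.length < L₂) : ∑ a, condProb C T h a = 1 := by
  simp only [condProb]
  rw [sum_norm_projectColumn_sq hlt, C.norm_applyV, norm_normalize_compressionAt hh, one_pow]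

theorem sum_tailProb {n : ℕ} {h : List (Column q L₁)} (hn : h.length + n ≤ L₂)
    (hh : ‖stateBefore C T h‖ = 1) :
    ∑ y : Fin n → Column q L₁, tailProb C T h (List.ofFn y) = 1 := by
  induction n generalizing h with
  | zero => simp [tailProb]
  | succ n ih =>
    rw [sum_ofFn_succ (tailProb C T h), ← sum_condProb hh (by omega)]
    refine Finset.sum_congr rfl fun a _ => ?_
    simp only [tailProb]
    rw [← Finset.mul_sum]
    by_cases ha : condProb C T h a = 0
    · rw [ha, zero_mul]
    · rw [ih (by rw [List.length_cons]; omega) (norm_stateBefore_cons ha), mul_one]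

/-- After a compression, the exact process for the remaining columns continues from the next state of
the algorithm, with the weight of the outcome that the algorithm observes. -/
theorem norm_exactRun_cons_sq (h y : List (Column q L₁)) (a : Column q L₁) :
    ‖C.exactRun h.length (a :: y) (normalize (compressionAt C T h).result)‖ ^ 2 =
      condProb C T h a * ‖C.exactRun (h.length + 1) y (stateBefore C T (a :: h))‖ ^ 2 := by
  rw [Circuit.exactRun, ← norm_smul_normalize (projectColumn _ _ _), Circuit.exactRun_smul,
    norm_smul, mul_pow, Complex.norm_real, norm_norm]
  rfl

/-- The hybrid argument: from the state of the algorithm after the outcomes `h`, the outcomes sampled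
by the algorithm and those of the exact process for the remaining `n` columns differ in distribution
in total variation (half the `ℓ¹` distance) by at most the expected sum of the compression errors still
to come. -/
theorem sum_abs_tailProb_sub_le {n : ℕ} {h : List (Column q L₁)} (hn : h.length + n ≤ L₂)
    (hh : ‖stateBefore C T h‖ = 1) :
    ∑ y : Fin n → Column q L₁, |tailProb C T h (List.ofFn y) -
        ‖C.exactRun h.length (List.ofFn y) (stateBefore C T h)‖ ^ 2| ≤
      2 * ∑ y : Fin n → Column q L₁,
        tailProb C T h (List.ofFn y) * tailError C T h (List.ofFn y) := by
  induction n generalizing h with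
  | zero => simp [tailProb, tailError, Circuit.exactRun, hh]
  | succ n ih =>
    set δ := stepError C T h with hδ
    set φ := normalize (compressionAt C T h).result with hφ
    -- The change from the state to its compression,
    have h1 : ∑ y : Fin (n + 1) → Column q L₁,
        |‖C.exactRun h.length (List.ofFn y) φ‖ ^ 2 -
          ‖C.exactRun h.length (List.ofFn y) (stateBefore C T h)‖ ^ 2| ≤ 2 * δ := by
      refine (C.sum_abs_norm_exactRun_sq_sub_le hn (norm_normalize_compressionAt hh) hh).trans ?_
      rw [norm_sub_rev]
      exact mul_le_mul_of_nonneg_left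
        (Compression.norm_sub_normalize_le (compressionAt C T h) hh) zero_le_two
    -- and, conditioned on the outcome of the next column, the later compressions.
    have h2 : ∑ y : Fin (n + 1) → Column q L₁,
        |tailProb C T h (List.ofFn y) - ‖C.exactRun h.length (List.ofFn y) φ‖ ^ 2| ≤
          ∑ a, condProb C T h a * (2 * ∑ y : Fin n → Column q L₁,
            tailProb C T (a :: h) (List.ofFn y) * tailError C T (a :: h) (List.ofFn y)) := by
      rw [sum_ofFn_succ fun y => |tailProb C T h y - ‖C.exactRun h.length y φ‖ ^ 2|]
      refine Finset.sum_le_sum fun a _ => ?_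
      simp only [hφ, norm_exactRun_cons_sq, tailProb, ← mul_sub, abs_mul,
        abs_of_nonneg (condProb_nonneg C T h a)]
      rw [← Finset.mul_sum]
      by_cases ha : condProb C T h a = 0
      · rw [ha, zero_mul, zero_mul]
      · exact mul_le_mul_of_nonneg_left
          (ih (h := a :: h) (by rw [List.length_cons]; omega) (norm_stateBefore_cons ha))
          (condProb_nonneg C T h a)
    have h3 : 2 * ∑ y : Fin (n + 1) → Column q L₁,
        tailProb C T h (List.ofFn y) * tailError C T h (List.ofFn y) =
        2 * δ + ∑ a, condProb C T h a * (2 * ∑ y : Fin n → Column q L₁,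
            tailProb C T (a :: h) (List.ofFn y) * tailError C T (a :: h) (List.ofFn y)) := by
      have hδ1 : ∑ a, ∑ y : Fin n → Column q L₁,
          condProb C T h a * tailProb C T (a :: h) (List.ofFn y) * δ = δ := by
        have := sum_tailProb hn hh
        rw [sum_ofFn_succ (tailProb C T h)] at this
        simp only [tailProb] at this
        simp only [← Finset.sum_mul]
        rw [this, one_mul]
      rw [sum_ofFn_succ fun y => tailProb C T h y * tailError C T h y]
      simp only [tailProb, tailError, ← hδ, mul_add, Finset.sum_add_distrib, hδ1]
      simp only [Finset.mul_sum]
      congr 1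
      exact Finset.sum_congr rfl fun a _ => Finset.sum_congr rfl fun y _ => by ring
    rw [h3]
    refine le_trans ?_ ((add_le_add h2 h1).trans_eq (add_comm _ _))
    rw [← Finset.sum_add_distrib]
    exact Finset.sum_le_sum fun y _ => abs_sub_le _ _ _

theorem sampleProb_nonneg (x : Config q L₁ L₂) : 0 ≤ sampleProb C T x :=
  Finset.prod_nonneg fun _ _ => condProb_nonneg C T _ _

end Algorithm

theorem sum_config (F : List (Column q L₁) → ℝ) :
    ∑ x : Config q L₁ L₂, F (List.ofFn fun j i => x (i, j)) =
      ∑ y : Fin L₂ → Column q L₁, F (List.ofFn y) :=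
  Fintype.sum_equiv ((Equiv.arrowCongr (Equiv.prodComm _ _) (Equiv.refl _)).trans
    (Equiv.curry (Fin L₂) (Fin L₁) (Fin q))) _ _ fun _ => rfl

end SEBD

theorem mainTheorem4 (q L₁ L₂ : ℕ) [NeZero q] (C : SEBD.Circuit q L₁ L₂) (ε : ℝ) (hε : 0 ≤ ε)
    (T : SEBD.Compressor q L₁ L₂ ε) :
    (1 / 2 : ℝ) * ∑ x, |SEBD.sampleProb C T x - C.outputProb x| ≤
        SEBD.expect C T (fun x => ∑ t : Fin L₂, √(2 * SEBD.truncError C T x t)) ∧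
      SEBD.expect C T (fun x => ∑ t : Fin L₂, √(2 * SEBD.truncError C T x t)) ≤
        √2 * SEBD.expect C T (SEBD.totalDiscarded C T) := by
  constructor
  · have hinit : ‖SEBD.stateBefore C T []‖ = 1 := by
      simp [SEBD.stateBefore, SEBD.initialState]
    have h : ∑ y : Fin L₂ → SEBD.Column q L₁, |SEBD.tailProb C T [] (List.ofFn y) -
        ‖C.exactRun 0 (List.ofFn y) (SEBD.initialState q L₁ L₂)‖ ^ 2| ≤ _ :=
      SEBD.sum_abs_tailProb_sub_le (C := C) (T := T) (n := L₂) (h := [])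
        (by simp) hinit
    rw [← SEBD.sum_config fun y => |SEBD.tailProb C T [] y -
        ‖C.exactRun 0 y (SEBD.initialState q L₁ L₂)‖ ^ 2|,
      ← SEBD.sum_config fun y => SEBD.tailProb C T [] y * SEBD.tailError C T [] y] at h
    simp only [SEBD.tailProb_eq_sampleProb, SEBD.tailError_eq, C.norm_exactRun_sq] at h
    rw [SEBD.expect]
    linarith
  · rw [SEBD.expect, SEBD.expect, Finset.mul_sum]
    refine Finset.sum_le_sum fun x _ => ?_
    rw [mul_left_comm]
    refine mul_le_mul_of_nonneg_left ?_ (SEBD.sampleProb_nonneg x)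
    rw [SEBD.totalDiscarded, Finset.mul_sum]
    refine Finset.sum_le_sum fun t _ => ?_
    rw [Real.sqrt_mul zero_le_two]
    exact mul_le_mul_of_nonneg_left
      (Real.sqrt_le_iff.2 ⟨SEBD.Sweep.discardedSum_nonneg _, SEBD.Sweep.discardedSq_le _⟩)
      (Real.sqrt_nonneg _)
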